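/- Let $P(\lambda)=P_0+\lambda P_1+\lambda^2P_2\in\mathbb{C}[\lambda]^{m\times n}$ and suppose $P_2=U_2\widehat T V_2^*$, where $\widehat T\in\mathbb{C}^{r_2\times r_2}$ is invertible and $U_2\in\mathbb{C}^{m\times r_2}$, $V_2\in\mathbb{C}^{n\times r_2}$ have orthonormal columns. Put $$\widehat L_s(\lambda)=\begin{bmatrix}-\widehat T & \lambda\widehat T V_2^*\\ \lambda U_2\widehat T & \lambda P_1+P_0\end{bmatrix}\in\mathbb{C}[\lambda]^{(r_2+m)\times(r_2+n)}.$$ For a polynomial matrix $Q(\lambda)$ with entries of degree at most $k$ write $\mathrm{rev}_kQ(\lambda)=\lambda^kQ(1/\lambda)$. For a rational matrix $R(\lambda)$ of normal rank $r$ (its rank over $\mathbb{C}(\lambda)$) there are square rational matrices $M_\ell(\lambda),M_r(\lambda)$, with no pole at $0$ and with $M_\ell(0),M_r(0)$ invertible, such that $$M_\ell(\lambda)R(\lambda)M_r(\lambda)=\mathrm{diag}(\lambda^{d_1},\dots,\lambda^{d_r},0)$$ for unique integers $d_1\le\cdots\le d_r$; the partial multiplicities of $R(\lambda)$ at $0$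 are the strictly positive numbers among the $d_i$, in nondecreasing order (there may be none). Let $r_P$ be the normal rank of $P(\lambda)$. Then the list of partial multiplicities $0<\widetilde e_1\le\cdots\le\widetilde e_u$ of $\mathrm{rev}_1\widehat L_s(\lambda)$ at $0$ exists and is unique, $r_2+u\le r_P$, and the list of partial multiplicities of $\mathrm{rev}_2P(\lambda)$ at $0$ exists, is unique, and is $$\underbrace{1=\cdots=1}_{r_P-r_2-u}\le\widetilde e_1+1\le\cdots\le\widetilde e_u+1 .$$ -/

import Mathlib

open Polynomial Matrix

noncomputable section

namespace QuadLin

/-- The polynomial matrix `P` regarded as a matrix over the field `ℂ(λ)`. -/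
def toRat {m n : ℕ} (P : Matrix (Fin m) (Fin n) ℂ[X]) :
    Matrix (Fin m) (Fin n) (RatFunc ℂ) :=
  P.map (algebraMap ℂ[X] (RatFunc ℂ))

/-- The normal rank of a polynomial matrix: its rank over `ℂ(λ)`, that is, the size of its largest
minor that is not identically zero. -/
def normalRank {m n : ℕ} (P : Matrix (Fin m) (Fin n) ℂ[X]) : ℕ :=
  (toRat P).rank

/-- The square rational matrix `M` is regular at the point `a`: no entry has a pole at `a`, and
the constant matrix `M(a)` is invertible. -/
def RegularAt {m : ℕ} (M : Matrix (Fin m) (Fin m) (RatFunc ℂ)) (a : ℂ) : Prop :=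
  (∀ i j, (M i j).denom.eval a ≠ 0) ∧ IsUnit (M.map (RatFunc.eval (RingHom.id ℂ) a))

/-- The `m × n` matrix `diag((λ - a)^{d₁}, …, (λ - a)^{d_r}, 0_{(m-r) × (n-r)})`, for a list
`d = [d₁, …, d_r]` of integers. -/
def localDiag (m n : ℕ) (a : ℂ) (d : List ℤ) : Matrix (Fin m) (Fin n) (RatFunc ℂ) :=
  Matrix.of fun i j =>
    if h : i.val = j.val ∧ i.val < d.length then
      (RatFunc.X - RatFunc.C a) ^ (d[i.val]'h.2)
    else 0

/-- `d` is the list `d₁ ≤ ⋯ ≤ d_r` of structural indices of the rational matrix `R` at `a`, where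
`r` is the normal rank of `R`: the exponents in the local Smith–McMillan form of `R` at `a`. -/
def IsStructuralIndices {m n : ℕ} (R : Matrix (Fin m) (Fin n) (RatFunc ℂ)) (a : ℂ)
    (d : List ℤ) : Prop :=
  d.length = R.rank ∧ d.Pairwise (· ≤ ·) ∧
    ∃ (M : Matrix (Fin m) (Fin m) (RatFunc ℂ)) (N : Matrix (Fin n) (Fin n) (RatFunc ℂ)),
      RegularAt M a ∧ RegularAt N a ∧ M * R * N = localDiag m n a d

/-- `e` is the list, in nondecreasing order, of the partial multiplicities of `R` at `a` (as a
zero): the strictly positive structural indices of `R` at `a`. The list is empty when `a` is not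
a zero of `R`. -/
def IsPartialMultiplicities {m n : ℕ} (R : Matrix (Fin m) (Fin n) (RatFunc ℂ)) (a : ℂ)
    (e : List ℕ) : Prop :=
  ∃ d : List ℤ, IsStructuralIndices R a d ∧
    d.filter (fun k => 0 < k) = e.map (fun k : ℕ => (k : ℤ))

/-- The reversal `rev_k P (λ) = λ^k P(1/λ)`, regarded as a matrix over `ℂ(λ)` (its entries are
polynomials when the entries of `P` have degree at most `k`). -/
def rev {m n : ℕ} (k : ℕ) (P : Matrix (Fin m) (Fin n) ℂ[X]) :
    Matrix (Fin m) (Fin n) (RatFunc ℂ) :=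
  Matrix.of fun i j => RatFunc.X ^ k * aeval (RatFunc.X : RatFunc ℂ)⁻¹ (P i j)

/-- The quadratic polynomial matrix `P₀ + λ P₁ + λ² P₂`. -/
def quadratic {m n : ℕ} (P₀ P₁ P₂ : Matrix (Fin m) (Fin n) ℂ) : Matrix (Fin m) (Fin n) ℂ[X] :=
  P₀.map C + (X : ℂ[X]) • P₁.map C + (X ^ 2 : ℂ[X]) • P₂.map C

/-- The pencil `[-T, λ T V*; λ U T, λ P₁ + P₀]` of size `(r + m) × (r + n)`. -/
def pencil {m n r : ℕ} (P₀ P₁ : Matrix (Fin m) (Fin n) ℂ) (T : Matrix (Fin r) (Fin r) ℂ)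
    (U : Matrix (Fin m) (Fin r) ℂ) (V : Matrix (Fin n) (Fin r) ℂ) :
    Matrix (Fin (r + m)) (Fin (r + n)) ℂ[X] :=
  (Matrix.fromBlocks ((-T).map C) ((X : ℂ[X]) • (T * Vᴴ).map C)
    ((X : ℂ[X]) • (U * T).map C) ((X : ℂ[X]) • P₁.map C + P₀.map C)).reindex
      finSumFinEquiv finSumFinEquiv

end QuadLin

end

namespace QuadLin

section Equivalence

variable {R S ι κ ι' κ' ι'' κ'' : Type*} [CommRing R] [CommRing S]
  [Fintype ι] [Fintype κ] [Fintype ι'] [Fintype κ'] [Fintype ι''] [Fintype κ'']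
  [DecidableEq ι] [DecidableEq κ] [DecidableEq ι'] [DecidableEq κ'] [DecidableEq ι'']
  [DecidableEq κ'']

/-- Equivalence of matrices over a commutative ring: `B = P A Q` with `P` and `Q` invertible. The
index types may differ, so that reindexing is a special case. -/
def MatEquiv (A : Matrix ι κ R) (B : Matrix ι' κ' R) : Prop :=
  ∃ (P : Matrix ι' ι R) (P' : Matrix ι ι' R) (Q : Matrix κ κ' R) (Q' : Matrix κ' κ R),
    P * P' = 1 ∧ P' * P = 1 ∧ Q * Q' = 1 ∧ Q' * Q = 1 ∧ P * A * Q = B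

theorem MatEquiv.refl (A : Matrix ι κ R) : MatEquiv A A :=
  ⟨1, 1, 1, 1, by simp⟩

theorem MatEquiv.symm {A : Matrix ι κ R} {B : Matrix ι' κ' R} (h : MatEquiv A B) :
    MatEquiv B A := by
  obtain ⟨P, P', Q, Q', h1, h2, h3, h4, rfl⟩ := h
  refine ⟨P', P, Q', Q, h2, h1, h4, h3, ?_⟩
  calc P' * (P * A * Q) * Q' = (P' * P) * A * (Q * Q') := by simp only [Matrix.mul_assoc]
    _ = A := by simp [h2, h3]

theorem MatEquiv.trans {A : Matrix ι κ R} {B : Matrix ι' κ' R} {C : Matrix ι'' κ'' R}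
    (h : MatEquiv A B) (h' : MatEquiv B C) : MatEquiv A C := by
  obtain ⟨P, P', Q, Q', h1, h2, h3, h4, rfl⟩ := h
  obtain ⟨S, S', T, T', k1, k2, k3, k4, rfl⟩ := h'
  refine ⟨S * P, P' * S', Q * T, T' * Q', ?_, ?_, ?_, ?_, by simp only [Matrix.mul_assoc]⟩
  · rw [Matrix.mul_assoc, ← Matrix.mul_assoc P, h1, Matrix.one_mul, k1]
  · rw [Matrix.mul_assoc, ← Matrix.mul_assoc S', k2, Matrix.one_mul, h2]
  · rw [Matrix.mul_assoc, ← Matrix.mul_assoc T, k3, Matrix.one_mul, h3]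
  · rw [Matrix.mul_assoc, ← Matrix.mul_assoc Q', h4, Matrix.one_mul, k4]

theorem MatEquiv.map {A : Matrix ι κ R} {B : Matrix ι' κ' R} (h : MatEquiv A B) (f : R →+* S) :
    MatEquiv (A.map f) (B.map f) := by
  obtain ⟨P, P', Q, Q', h1, h2, h3, h4, rfl⟩ := h
  refine ⟨P.map f, P'.map f, Q.map f, Q'.map f, ?_, ?_, ?_, ?_, ?_⟩
  all_goals simp only [← Matrix.map_mul, *]
  all_goals exact Matrix.map_one _ (map_zero f) (map_one f)

theorem MatEquiv.smul {A : Matrix ι κ R} {B : Matrix ι' κ' R} (h : MatEquiv A B) (c : R) :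
    MatEquiv (c • A) (c • B) := by
  obtain ⟨P, P', Q, Q', h1, h2, h3, h4, rfl⟩ := h
  exact ⟨P, P', Q, Q', h1, h2, h3, h4, by simp⟩

theorem matEquiv_submatrix (A : Matrix ι κ R) (e : ι' ≃ ι) (f : κ' ≃ κ) :
    MatEquiv A (A.submatrix e f) := by
  refine ⟨(1 : Matrix ι ι R).submatrix e id, (1 : Matrix ι ι R).submatrix id e,
    (1 : Matrix κ κ R).submatrix id f, (1 : Matrix κ κ R).submatrix f id, ?_, ?_, ?_, ?_, ?_⟩
  · ext i j; simp [Matrix.mul_apply, Matrix.one_apply]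
  · ext i j; simp [Matrix.mul_apply, Matrix.one_apply, ← Equiv.eq_symm_apply]
  · ext i j; simp [Matrix.mul_apply, Matrix.one_apply, ← Equiv.eq_symm_apply]
  · ext i j; simp [Matrix.mul_apply, Matrix.one_apply]
  · ext i j; simp [Matrix.mul_apply, Matrix.one_apply]

theorem matEquiv_reindex (A : Matrix ι κ R) (e : ι ≃ ι') (f : κ ≃ κ') :
    MatEquiv A (A.reindex e f) :=
  matEquiv_submatrix A e.symm f.symm

theorem MatEquiv.fromBlocks_diag {ι₁ κ₁ : Type*} [Fintype ι₁] [Fintype κ₁] [DecidableEq ι₁]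
    [DecidableEq κ₁] (D : Matrix ι₁ κ₁ R) {A : Matrix ι κ R} {B : Matrix ι' κ' R}
    (h : MatEquiv A B) :
    MatEquiv (fromBlocks D 0 0 A) (fromBlocks D 0 0 B) := by
  obtain ⟨P, P', Q, Q', h1, h2, h3, h4, rfl⟩ := h
  exact ⟨fromBlocks 1 0 0 P, fromBlocks 1 0 0 P', fromBlocks 1 0 0 Q, fromBlocks 1 0 0 Q',
    by simp [fromBlocks_multiply, *], by simp [fromBlocks_multiply, *],
    by simp [fromBlocks_multiply, *], by simp [fromBlocks_multiply, *],
    by simp [fromBlocks_multiply]⟩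

/-- Block elimination with an invertible leading block. -/
theorem matEquiv_schur (A A' : Matrix ι'' ι'' R) (h : A' * A = 1) (B : Matrix ι'' κ R)
    (C : Matrix ι ι'' R) (D : Matrix ι κ R) :
    MatEquiv (fromBlocks A B C D) (fromBlocks (1 : Matrix ι'' ι'' R) 0 0 (D - C * A' * B)) := by
  have h' : A * A' = 1 := mul_eq_one_comm.mp h
  refine ⟨fromBlocks A' 0 (-(C * A')) 1, fromBlocks A 0 C 1, fromBlocks 1 (-(A' * B)) 0 1,
    fromBlocks 1 (A' * B) 0 1, ?_, ?_, ?_, ?_, ?_⟩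
  · simp [fromBlocks_multiply, h, Matrix.mul_assoc]
  · simp [fromBlocks_multiply, h']
  · simp [fromBlocks_multiply]
  · simp [fromBlocks_multiply]
  · simp only [fromBlocks_multiply, h, Matrix.mul_assoc, Matrix.mul_one, Matrix.one_mul,
      Matrix.mul_zero, Matrix.zero_mul, add_zero, Matrix.neg_mul, Matrix.mul_neg]
    congr 1
    · simp
    · simp
    · rw [neg_add_cancel, Matrix.zero_mul]; abel

theorem MatEquiv.rank_eq {F : Type*} [Field F] {A : Matrix ι κ F} {B : Matrix ι' κ' F}
    (h : MatEquiv A B) : A.rank = B.rank := by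
  obtain ⟨P', P, Q', Q, h1, h2, h3, h4, h5⟩ := h.symm
  obtain ⟨P, _, Q, _, -, -, -, -, rfl⟩ := h
  refine le_antisymm ?_ ((rank_mul_le_left _ _).trans (rank_mul_le_right _ _))
  conv_lhs => rw [← h5]
  exact (rank_mul_le_left _ _).trans (rank_mul_le_right _ _)

end Equivalence

section Smith

variable {R S : Type*} [CommRing R] [CommRing S]

/-- The `m × n` matrix with diagonal `x ^ d₁, …, x ^ d_r` followed by zeros. -/
def powDiag (m n : ℕ) (x : R) (d : List ℕ) : Matrix (Fin m) (Fin n) R :=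
  Matrix.of fun i j => if h : i.val = j.val ∧ i.val < d.length then x ^ (d[i.val]'h.2) else 0

theorem powDiag_nil (m n : ℕ) (x : R) : powDiag m n x [] = 0 := by
  ext; simp [powDiag]

theorem powDiag_map (m n : ℕ) (x : R) (d : List ℕ) (f : R →+* S) :
    (powDiag m n x d).map f = powDiag m n (f x) d := by
  ext i j
  simp only [powDiag, Matrix.map_apply, Matrix.of_apply]
  split_ifs <;> simp

theorem powDiag_replicate_zero (m : ℕ) (x : R) : powDiag m m x (List.replicate m 0) = 1 := by
  ext i j
  simp only [powDiag, Matrix.of_apply, Matrix.one_apply, Fin.ext_iff]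
  by_cases h : i.val = j.val <;> simp [h]

theorem powDiag_one_one (x : R) (k : ℕ) : powDiag 1 1 x [k] = x ^ k • 1 := by
  ext i j
  fin_cases i; fin_cases j
  simp [powDiag]

theorem smul_powDiag (m n : ℕ) (x : R) (d : List ℕ) :
    x • powDiag m n x d = powDiag m n x (d.map (· + 1)) := by
  ext i j
  simp only [powDiag, Matrix.smul_apply, Matrix.of_apply, List.length_map, List.getElem_map]
  split_ifs <;> simp [pow_succ']

theorem powDiag_append (m n : ℕ) (x : R) (d d' : List ℕ) :
    powDiag (d.length + m) (d.length + n) x (d ++ d') =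
      (fromBlocks (powDiag d.length d.length x d) 0 0 (powDiag m n x d')).reindex
        finSumFinEquiv finSumFinEquiv := by
  ext i j
  obtain ⟨i, rfl⟩ := finSumFinEquiv.surjective i
  obtain ⟨j, rfl⟩ := finSumFinEquiv.surjective j
  rcases i with i | i <;> rcases j with j | j
  · have := i.2
    simp [powDiag, List.getElem_append]
    by_cases h : i.val = j.val <;> simp [h]
    omega
  · have := i.2
    simp [powDiag]
    intro h; omega
  · have := j.2
    simp [powDiag]
    intro h; omega
  · simp [powDiag, List.getElem_append]

theorem matEquiv_powDiag_append {ι κ : Type*} [Fintype ι] [Fintype κ] [DecidableEq ι]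
    [DecidableEq κ] {m n a : ℕ} {x : R} {d d' : List ℕ} (ha : d.length = a) {A : Matrix ι κ R}
    (h : MatEquiv A (powDiag m n x d')) :
    MatEquiv (fromBlocks (powDiag a a x d) 0 0 A) (powDiag (a + m) (a + n) x (d ++ d')) := by
  subst ha
  rw [powDiag_append]
  exact (h.fromBlocks_diag _).trans (matEquiv_reindex _ _ _)

theorem rank_powDiag {F : Type*} [Field F] {m n : ℕ} {x : F} (hx : x ≠ 0) {d : List ℕ}
    (hm : d.length ≤ m) (hn : d.length ≤ n) : (powDiag m n x d).rank = d.length := by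
  obtain ⟨m, rfl⟩ := Nat.exists_eq_add_of_le hm
  obtain ⟨n, rfl⟩ := Nat.exists_eq_add_of_le hn
  have hD : powDiag d.length d.length x d = diagonal fun i => x ^ d[i.val] := by
    ext i j
    simp only [powDiag, Matrix.of_apply, diagonal_apply, Fin.ext_iff]
    by_cases h : i.val = j.val <;> simp [h]
  have hr : (powDiag d.length d.length x d).rank = d.length := by
    rw [hD, rank_of_isUnit, Fintype.card_fin]
    rw [Matrix.isUnit_iff_isUnit_det, det_diagonal]
    exact (Finset.prod_ne_zero_iff.mpr fun i _ => pow_ne_zero _ hx).isUnit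
  have h := powDiag_append m n x d []
  rw [List.append_nil, powDiag_nil] at h
  rw [h, rank_reindex]
  apply le_antisymm
  · have : fromBlocks (powDiag d.length d.length x d) 0 0 (0 : Matrix (Fin m) (Fin n) F) =
        fromRows (1 : Matrix (Fin d.length) (Fin d.length) F) 0 * powDiag d.length d.length x d *
            fromCols (1 : Matrix (Fin d.length) (Fin d.length) F) 0 := by
      rw [Matrix.fromRows_mul, fromRows_mul_fromCols]; simp
    rw [this]
    exact ((rank_mul_le_left _ _).trans (rank_mul_le_right _ _)).trans hr.le
  · calc d.length = (powDiag d.length d.length x d).rank := hr.symm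
      _ = ((fromBlocks (powDiag d.length d.length x d) 0 0
            (0 : Matrix (Fin m) (Fin n) F)).submatrix Sum.inl Sum.inl).rank := rfl
      _ ≤ _ := rank_submatrix_le _ _ _

/-- The Smith form over a domain in which every nonzero element is associated to a power of a
fixed element `x`. -/
theorem exists_matEquiv_powDiag [IsDomain R] {x : R}
    (hx : ∀ r : R, r ≠ 0 → ∃ k : ℕ, Associated (x ^ k) r) :
    ∀ {m n : ℕ} (k : ℕ) (A : Matrix (Fin m) (Fin n) R), (∀ i j, x ^ k ∣ A i j) →
      ∃ d : List ℕ, d.length ≤ m ∧ d.length ≤ n ∧ d.Pairwise (· ≤ ·) ∧ (∀ e ∈ d, k ≤ e) ∧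
        MatEquiv A (powDiag m n x d) := by
  intro m
  induction m with
  | zero =>
    intro n k A _
    refine ⟨[], by simp, by simp, by simp, by simp, ?_⟩
    rw [powDiag_nil, show A = 0 from Subsingleton.elim _ _]
    exact MatEquiv.refl _
  | succ m ih =>
    intro n k A hA
    by_cases h0 : A = 0
    · refine ⟨[], by simp, by simp, by simp, by simp, ?_⟩
      rw [powDiag_nil, h0]
      exact MatEquiv.refl _
    obtain ⟨K, hkK, i, j, hij, hall⟩ : ∃ K, k ≤ K ∧ ∃ i j, Associated (x ^ K) (A i j) ∧
        ∀ i j, x ^ K ∣ A i j := by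
      have hex : ∃ K i j, A i j ≠ 0 ∧ Associated (x ^ K) (A i j) := by
        by_contra! hne
        apply h0
        ext i j
        by_contra hij
        obtain ⟨K, hK⟩ := hx _ hij
        exact hne K i j hij hK
      classical
      obtain ⟨i, j, hij, hK⟩ := Nat.find_spec hex
      have hall : ∀ i j, x ^ Nat.find hex ∣ A i j := by
        intro i' j'
        by_cases hz : A i' j' = 0
        · rw [hz]; exact dvd_zero _
        · obtain ⟨K', hK'⟩ := hx _ hz
          exact (pow_dvd_pow x (Nat.find_min' hex ⟨i', j', hz, hK'⟩)).trans hK'.dvd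
      rcases le_total k (Nat.find hex) with h | h
      · exact ⟨_, h, i, j, hK, hall⟩
      · exact ⟨k, le_rfl, i, j, associated_of_dvd_dvd (hA i j)
          (hK.symm.dvd.trans (pow_dvd_pow x h)), hA⟩
    obtain ⟨n, rfl⟩ : ∃ n', n = 1 + n' := ⟨n - 1, by have := j.2; omega⟩
    obtain ⟨m', hm', rfl⟩ : ∃ m', m + 1 = 1 + m' ∧ m' = m := ⟨m, by omega, rfl⟩
    revert A i
    rw [hm']
    intro i A hA h0 hij hall
    let e : Fin 1 ⊕ Fin m' ≃ Fin (1 + m') :=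
      finSumFinEquiv.trans (Equiv.swap (finSumFinEquiv (Sum.inl 0)) i)
    let f : Fin 1 ⊕ Fin n ≃ Fin (1 + n) :=
      finSumFinEquiv.trans (Equiv.swap (finSumFinEquiv (Sum.inl 0)) j)
    have he : e (Sum.inl 0) = i := by simp [e]
    have hf : f (Sum.inl 0) = j := by simp [f]
    obtain ⟨u, hu⟩ := hij
    choose Q hQ using hall
    let B : Matrix (Fin 1 ⊕ Fin m') (Fin 1 ⊕ Fin n) R :=
      fromBlocks ((u : R) • 1) (Matrix.of fun a b => Q (e (Sum.inl a)) (f (Sum.inr b)))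
        (Matrix.of fun a b => Q (e (Sum.inr a)) (f (Sum.inl b)))
        (Matrix.of fun a b => Q (e (Sum.inr a)) (f (Sum.inr b)))
    have hB : A.submatrix e f = x ^ K • B := by
      ext a b
      rcases a with a | a <;> rcases b with b | b
      · fin_cases a; fin_cases b
        simp [B, he, hf, hu]
      all_goals simp [B, hQ]
    have h1 : ((u⁻¹ : Rˣ) : R) • (1 : Matrix (Fin 1) (Fin 1) R) * ((u : R) • 1) = 1 := by
      simp [smul_smul]
    obtain ⟨D, hD⟩ : ∃ D, MatEquiv B (fromBlocks (1 : Matrix (Fin 1) (Fin 1) R) 0 0 D) :=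
      ⟨_, matEquiv_schur _ _ h1 _ _ _⟩
    have h2 := hD.smul (x ^ K)
    rw [fromBlocks_smul (x ^ K) 1, smul_zero, smul_zero] at h2
    obtain ⟨d, hd1, hd2, hd3, hd4, hd5⟩ := ih K (x ^ K • D) fun i j => Dvd.intro _ rfl
    refine ⟨K :: d, by simp; omega, by simp; omega, List.pairwise_cons.mpr ⟨hd4, hd3⟩, ?_,
      (matEquiv_submatrix A e f).trans ?_⟩
    · intro a ha
      rcases List.mem_cons.mp ha with rfl | ha
      · exact hkK
      · exact hkK.trans (hd4 a ha)
    · rw [hB]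
      refine MatEquiv.trans h2 ?_
      rw [← powDiag_one_one]
      exact matEquiv_powDiag_append (d := [K]) rfl hd5

theorem rank_map_ringHom {F G : Type*} [Field F] [Field G] {m n : ℕ}
    (A : Matrix (Fin m) (Fin n) F) (f : F →+* G) : (A.map f).rank = A.rank := by
  obtain ⟨d, h1, h2, -, -, h⟩ := exists_matEquiv_powDiag (x := (1 : F))
    (fun r hr => ⟨0, by
      rw [pow_zero]
      exact (associated_one_iff_isUnit.mpr hr.isUnit).symm⟩) 0 A (by simp)
  rw [h.rank_eq, (h.map f).rank_eq, powDiag_map, map_one, rank_powDiag one_ne_zero h1 h2,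
    rank_powDiag one_ne_zero h1 h2]

end Smith

/-- The local ring of rational functions without a pole at `0`. -/
def regularAtZero : Subring (RatFunc ℂ) where
  carrier := {f | f.denom.eval 0 ≠ 0}
  mul_mem' {f g} hf hg h := by
    have := eval_dvd (x := (0 : ℂ)) (RatFunc.denom_mul_dvd f g)
    rw [h, eval_mul, zero_dvd_iff] at this
    exact mul_ne_zero hf hg this
  one_mem' := by simp
  add_mem' {f g} hf hg h := by
    have := eval_dvd (x := (0 : ℂ)) (RatFunc.denom_add_dvd f g)
    rw [h, eval_mul, zero_dvd_iff] at this
    exact mul_ne_zero hf hg this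
  zero_mem' := by simp
  neg_mem' {f} hf h := by
    have hd : (-f).denom ∣ f.denom := by
      rw [RatFunc.denom_dvd f.denom_ne_zero]
      exact ⟨-f.num, by rw [map_neg, neg_div, RatFunc.num_div_denom]⟩
    have := eval_dvd (x := (0 : ℂ)) hd
    rw [h, zero_dvd_iff] at this
    exact hf this

theorem mem_regularAtZero {f : RatFunc ℂ} : f ∈ regularAtZero ↔ f.denom.eval 0 ≠ 0 := Iff.rfl

theorem div_mem_regularAtZero (p : ℂ[X]) {q : ℂ[X]} (hq : q.eval 0 ≠ 0) :
    algebraMap ℂ[X] (RatFunc ℂ) p / algebraMap ℂ[X] (RatFunc ℂ) q ∈ regularAtZero := by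
  intro h
  have := eval_dvd (x := (0 : ℂ)) (RatFunc.denom_div_dvd p q)
  rw [h, zero_dvd_iff] at this
  exact hq this

theorem algebraMap_mem_regularAtZero (p : ℂ[X]) :
    algebraMap ℂ[X] (RatFunc ℂ) p ∈ regularAtZero := by
  simp [mem_regularAtZero]

/-- The value at `0`. -/
noncomputable def evalZero : regularAtZero →+* ℂ where
  toFun f := RatFunc.eval (RingHom.id ℂ) 0 f
  map_one' := RatFunc.eval_one _ _
  map_zero' := RatFunc.eval_zero _ _
  map_mul' f g := RatFunc.eval_mul _ _ f.2 g.2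
  map_add' f g := RatFunc.eval_add _ _ f.2 g.2

theorem isUnit_regularAtZero_iff {f : regularAtZero} : IsUnit f ↔ evalZero f ≠ 0 := by
  refine ⟨fun h => (h.map evalZero).ne_zero, fun h => ?_⟩
  have hf : (f : RatFunc ℂ) ≠ 0 := by
    intro h0
    exact h (by rw [show f = 0 from Subtype.ext h0, map_zero])
  have hnum : (f : RatFunc ℂ).num.eval 0 ≠ 0 := by
    intro h0
    apply h
    change RatFunc.eval (RingHom.id ℂ) 0 (f : RatFunc ℂ) = 0
    rw [RatFunc.eval, eval₂_id, h0, zero_div]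
  have hinv : (f : RatFunc ℂ)⁻¹ ∈ regularAtZero := by
    rw [← RatFunc.num_div_denom (f : RatFunc ℂ), inv_div]
    exact div_mem_regularAtZero _ hnum
  exact IsUnit.of_mul_eq_one ⟨_, hinv⟩ (Subtype.ext (mul_inv_cancel₀ hf))

/-- The indeterminate as an element of the local ring at `0`. -/
noncomputable def localX : regularAtZero :=
  ⟨RatFunc.X, by rw [← RatFunc.algebraMap_X]; exact algebraMap_mem_regularAtZero _⟩

theorem coe_localX : (localX : RatFunc ℂ) = RatFunc.X := rfl

theorem evalZero_localX : evalZero localX = 0 := RatFunc.eval_X _ _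

theorem exists_associated_localX_pow (f : regularAtZero) (hf : f ≠ 0) :
    ∃ k : ℕ, Associated (localX ^ k) f := by
  have hf0 : (f : RatFunc ℂ) ≠ 0 := fun h => hf (Subtype.ext h)
  have hn : (f : RatFunc ℂ).num ≠ 0 := RatFunc.num_ne_zero hf0
  obtain ⟨q, hq, hnd⟩ := exists_eq_pow_rootMultiplicity_mul_and_not_dvd _ hn 0
  rw [dvd_iff_isRoot, IsRoot.def] at hnd
  set k := rootMultiplicity 0 (f : RatFunc ℂ).num
  have hden : (f : RatFunc ℂ).denom.eval 0 ≠ 0 := f.2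
  let g : regularAtZero := ⟨_, div_mem_regularAtZero q hden⟩
  let g' : regularAtZero := ⟨_, div_mem_regularAtZero (f : RatFunc ℂ).denom hnd⟩
  have hq0 : algebraMap ℂ[X] (RatFunc ℂ) q ≠ 0 :=
    RatFunc.algebraMap_ne_zero (by rintro rfl; simp at hnd)
  have hd0 : algebraMap ℂ[X] (RatFunc ℂ) (f : RatFunc ℂ).denom ≠ 0 :=
    RatFunc.algebraMap_ne_zero (f : RatFunc ℂ).denom_ne_zero
  have hg : IsUnit g := by
    refine IsUnit.of_mul_eq_one g' (Subtype.ext ?_)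
    change _ / _ * (_ / _) = (1 : RatFunc ℂ)
    field_simp
  refine ⟨k, hg.unit, Subtype.ext ?_⟩
  rw [IsUnit.unit_spec]
  change (RatFunc.X : RatFunc ℂ) ^ k * (_ / _) = _
  rw [← mul_div_assoc]
  conv_rhs => rw [← RatFunc.num_div_denom (f : RatFunc ℂ), hq]
  simp

theorem regularAt_zero_iff {m : ℕ} (M : Matrix (Fin m) (Fin m) (RatFunc ℂ)) :
    RegularAt M 0 ↔ ∃ N : Matrix (Fin m) (Fin m) regularAtZero,
      IsUnit N ∧ N.map regularAtZero.subtype = M := by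
  have key : ∀ N : Matrix (Fin m) (Fin m) regularAtZero,
      IsUnit N ↔ IsUnit (N.map evalZero) := by
    intro N
    rw [Matrix.isUnit_iff_isUnit_det, Matrix.isUnit_iff_isUnit_det, isUnit_regularAtZero_iff,
      isUnit_iff_ne_zero, RingHom.map_det]
    rfl
  constructor
  · rintro ⟨h1, h2⟩
    exact ⟨Matrix.of fun i j => ⟨M i j, h1 i j⟩, (key _).mpr h2, rfl⟩
  · rintro ⟨N, hN, rfl⟩
    exact ⟨fun i j => (N i j).2, (key N).mp hN⟩

theorem det_eq_zero_of_zero_block {F : Type*} [CommRing F] {m : ℕ} (A : Matrix (Fin m) (Fin m) F)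
    (k : Fin m) (h : ∀ i j, j ≤ k → k ≤ i → A i j = 0) : A.det = 0 := by
  rw [det_apply]
  refine Finset.sum_eq_zero fun σ _ => ?_
  obtain ⟨j, hj, hσ⟩ : ∃ j, j ≤ k ∧ k ≤ σ j := by
    by_contra! hne
    have := Finset.card_le_card_of_injOn σ (s := Finset.Iic k) (t := Finset.Iio k)
      (fun j hj => by simpa using hne j (by simpa using hj)) σ.injective.injOn
    simp at this
  have : ∏ i, A (σ i) i = 0 := Finset.prod_eq_zero (Finset.mem_univ j) (h _ _ hj hσ)
  rw [this, smul_zero]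

theorem localDiag_natCast (m n : ℕ) (d : List ℕ) :
    localDiag m n 0 (d.map (fun k : ℕ => (k : ℤ))) = powDiag m n (RatFunc.X : RatFunc ℂ) d := by
  ext i j
  simp [localDiag, powDiag]

theorem getElem_le_of_intertwine {m n r : ℕ} (hm : r ≤ m) (hn : r ≤ n) {d d' : List ℤ}
    (hd : d.length = r) (hd' : d'.length = r) (hs : d.Pairwise (· ≤ ·)) (hs' : d'.Pairwise (· ≤ ·))
    {M : Matrix (Fin m) (Fin m) regularAtZero} {N : Matrix (Fin n) (Fin n) regularAtZero}
    (hM : IsUnit M)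
    (h : M.map regularAtZero.subtype * localDiag m n 0 d =
      localDiag m n 0 d' * N.map regularAtZero.subtype) (k : ℕ) (hk : k < r) :
    d'[k] ≤ d[k] := by
  by_contra! hlt
  have hX : (RatFunc.X : RatFunc ℂ) ≠ 0 := RatFunc.X_ne_zero
  have hdet : (M.map evalZero).det = 0 := by
    refine det_eq_zero_of_zero_block _ ⟨k, by omega⟩ fun i j hj hi => ?_
    have hjk : j.val ≤ k := hj
    have hki : k ≤ i.val := hi
    have e := congrFun (congrFun h i) ⟨j.val, by omega⟩
    rw [Matrix.mul_apply, Matrix.mul_apply, Finset.sum_eq_single j] at e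
    rotate_left
    · intro b _ hb
      rw [localDiag, Matrix.of_apply, dif_neg, mul_zero]
      rintro ⟨h1, -⟩
      exact hb (Fin.ext h1)
    · simp
    have e1 : localDiag m n 0 d j ⟨j.val, by omega⟩ = RatFunc.X ^ d[j.val] := by
      rw [localDiag, Matrix.of_apply, dif_pos ⟨rfl, by omega⟩]; simp
    rw [e1] at e
    by_cases hir : i.val < r
    · rw [Finset.sum_eq_single ⟨i.val, by omega⟩] at e
      rotate_left
      · intro b _ hb
        rw [localDiag, Matrix.of_apply, dif_neg, zero_mul]
        rintro ⟨h1, -⟩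
        exact hb (Fin.ext h1.symm)
      · simp
      have e2 : localDiag m n 0 d' i ⟨i.val, by omega⟩ = RatFunc.X ^ d'[i.val] := by
        rw [localDiag, Matrix.of_apply, dif_pos ⟨rfl, by omega⟩]; simp
      rw [e2] at e
      have hlt' : d[j.val] < d'[i.val] :=
        ((hs.rel_get_of_le (a := ⟨j.val, by omega⟩) (b := ⟨k, by omega⟩) hjk).trans_lt hlt).trans_le
          (hs'.rel_get_of_le (a := ⟨k, by omega⟩) (b := ⟨i.val, by omega⟩) hki)
      obtain ⟨c, hc⟩ : ∃ c : ℕ, d'[i.val] = d[j.val] + ((c + 1 : ℕ) : ℤ) :=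
        ⟨(d'[i.val] - d[j.val] - 1).toNat, by omega⟩
      rw [hc, zpow_add₀ hX, zpow_natCast, mul_comm, mul_assoc] at e
      have e3 := mul_left_cancel₀ (zpow_ne_zero _ hX) e
      have e4 : M i j = localX ^ (c + 1) * N ⟨i.val, by omega⟩ ⟨j.val, by omega⟩ := by
        apply Subtype.ext
        simpa [coe_localX] using e3
      rw [Matrix.map_apply, e4, map_mul, map_pow, evalZero_localX]
      simp
    · rw [Finset.sum_eq_zero] at e
      · have e3 := (mul_eq_zero.mp e).resolve_right (zpow_ne_zero _ hX)
        have e4 : M i j = 0 := Subtype.ext e3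
        rw [Matrix.map_apply, e4, map_zero]
      · intro b _
        rw [localDiag, Matrix.of_apply, dif_neg, zero_mul]
        rintro ⟨-, h1⟩
        omega
  have hu := (Matrix.isUnit_iff_isUnit_det M).mp hM
  rw [isUnit_regularAtZero_iff, RingHom.map_det] at hu
  exact hu hdet

theorem IsStructuralIndices.unique {m n : ℕ} {R : Matrix (Fin m) (Fin n) (RatFunc ℂ)}
    {d d' : List ℤ} (h : IsStructuralIndices R 0 d) (h' : IsStructuralIndices R 0 d') :
    d = d' := by
  have key : ∀ {d d' : List ℤ}, IsStructuralIndices R 0 d → IsStructuralIndices R 0 d' →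
      ∀ (k : ℕ) (h1 : k < d.length) (h2 : k < d'.length), d'[k] ≤ d[k] := by
    rintro d d' ⟨hl, hs, M, N, hM, hN, h⟩ ⟨hl', hs', M', N', hM', hN', h'⟩ k h1 h2
    obtain ⟨M, ⟨M, rfl⟩, rfl⟩ := (regularAt_zero_iff _).mp hM
    obtain ⟨N, ⟨N, rfl⟩, rfl⟩ := (regularAt_zero_iff _).mp hN
    obtain ⟨M', ⟨M', rfl⟩, rfl⟩ := (regularAt_zero_iff _).mp hM'
    obtain ⟨N', ⟨N', rfl⟩, rfl⟩ := (regularAt_zero_iff _).mp hN'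
    refine getElem_le_of_intertwine (M := ((M' * M⁻¹ : _ˣ) : Matrix _ _ _))
      (N := ((N'⁻¹ * N : _ˣ) : Matrix _ _ _)) R.rank_le_height R.rank_le_width hl hl' hs hs'
      (Units.isUnit _) ?_ k (hl ▸ h1)
    have hM1 : regularAtZero.subtype.mapMatrix (M⁻¹ : _ˣ).val *
        regularAtZero.subtype.mapMatrix M.val = 1 := by
      rw [← map_mul, Units.inv_mul, map_one]
    have hN1 : regularAtZero.subtype.mapMatrix N'.val *
        regularAtZero.subtype.mapMatrix (N'⁻¹ : _ˣ).val = 1 := by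
      rw [← map_mul, Units.mul_inv, map_one]
    simp only [← RingHom.mapMatrix_apply] at h h' ⊢
    rw [Units.val_mul, Units.val_mul, map_mul, map_mul, ← h, ← h']
    set φ := (regularAtZero.subtype.mapMatrix :
      Matrix (Fin m) (Fin m) regularAtZero →+* Matrix (Fin m) (Fin m) (RatFunc ℂ))
    set ψ := (regularAtZero.subtype.mapMatrix :
      Matrix (Fin n) (Fin n) regularAtZero →+* Matrix (Fin n) (Fin n) (RatFunc ℂ))
    calc φ M'.val * φ (M⁻¹ : _ˣ).val * (φ M.val * R * ψ N.val)
        = φ M'.val * (φ (M⁻¹ : _ˣ).val * φ M.val) * R * ψ N.val := by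
          simp only [Matrix.mul_assoc]
      _ = φ M'.val * R * (ψ N'.val * ψ (N'⁻¹ : _ˣ).val) * ψ N.val := by
          rw [hM1, hN1, Matrix.mul_one, Matrix.mul_one]
      _ = _ := by simp only [Matrix.mul_assoc]
  refine List.ext_getElem (h.1.trans h'.1.symm) fun k h1 h2 => le_antisymm ?_ ?_
  · exact key h' h k h2 h1
  · exact key h h' k h1 h2

theorem isStructuralIndices_of_matEquiv {m n : ℕ} {A : Matrix (Fin m) (Fin n) regularAtZero}
    {d : List ℕ} (hm : d.length ≤ m) (hn : d.length ≤ n) (hs : d.Pairwise (· ≤ ·))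
    (h : MatEquiv A (powDiag m n localX d)) :
    IsStructuralIndices (A.map regularAtZero.subtype) 0 (d.map (fun k : ℕ => (k : ℤ))) := by
  refine ⟨?_, ?_, ?_⟩
  · rw [(h.map _).rank_eq, powDiag_map, rank_powDiag RatFunc.X_ne_zero hm hn, List.length_map]
  · rw [List.pairwise_map]
    exact hs.imp fun h => by exact_mod_cast h
  · obtain ⟨P, P', Q, Q', h1, h2, h3, h4, h⟩ := h
    refine ⟨P.map regularAtZero.subtype, Q.map regularAtZero.subtype,
      (regularAt_zero_iff _).mpr ⟨P, IsUnit.of_mul_eq_one P' h1, rfl⟩,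
      (regularAt_zero_iff _).mpr ⟨Q, IsUnit.of_mul_eq_one Q' h3, rfl⟩, ?_⟩
    rw [localDiag_natCast, ← Matrix.map_mul, ← Matrix.map_mul, h, powDiag_map]
    rfl

theorem isPartialMultiplicities_iff {m n : ℕ} {A : Matrix (Fin m) (Fin n) regularAtZero}
    {d : List ℕ} (hm : d.length ≤ m) (hn : d.length ≤ n) (hs : d.Pairwise (· ≤ ·))
    (h : MatEquiv A (powDiag m n localX d)) (e : List ℕ) :
    IsPartialMultiplicities (A.map regularAtZero.subtype) 0 e ↔
      e = d.filter (fun k => 0 < k) := by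
  have hA := isStructuralIndices_of_matEquiv hm hn hs h
  have hf : (d.map (fun k : ℕ => (k : ℤ))).filter (fun k => 0 < k) =
      (d.filter (fun k => 0 < k)).map (fun k : ℕ => (k : ℤ)) := by
    rw [List.filter_map]
    congr 1
    refine List.filter_congr fun k _ => ?_
    simp
  constructor
  · rintro ⟨d', hd', he⟩
    rw [hd'.unique hA, hf] at he
    exact (List.map_injective_iff.mpr Nat.cast_injective he).symm
  · rintro rfl
    exact ⟨_, hA, hf⟩

theorem eq_replicate_append_filter_pos {d : List ℕ} (hs : d.Pairwise (· ≤ ·)) :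
    d = List.replicate (d.length - (d.filter (fun k => 0 < k)).length) 0 ++
      d.filter (fun k => 0 < k) := by
  induction d with
  | nil => rfl
  | cons a d ih =>
    rw [List.pairwise_cons] at hs
    rcases Nat.eq_zero_or_pos a with rfl | ha
    · have hle := List.length_filter_le (fun k => decide (0 < k)) d
      rw [List.filter_cons_of_neg (by simp), List.length_cons, Nat.succ_sub hle,
        List.replicate_succ, List.cons_append, ← ih hs.2]
    · have : (a :: d).filter (fun k => 0 < k) = a :: d := by
        rw [List.filter_eq_self]
        intro b hb
        rcases List.mem_cons.mp hb with rfl | hb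
        · simpa using ha
        · simpa using ha.trans_le (hs.1 b hb)
      rw [this]; simp

/-- A matrix with a left inverse can be completed to an invertible matrix. -/
theorem exists_mul_eq_fromRows_one_zero {m r : ℕ} {U : Matrix (Fin m) (Fin r) ℂ}
    {L : Matrix (Fin r) (Fin m) ℂ} (h : L * U = 1) :
    ∃ m', m = r + m' ∧ ∃ (E : Matrix (Fin r ⊕ Fin m') (Fin m) ℂ)
      (E' : Matrix (Fin m) (Fin r ⊕ Fin m') ℂ),
      E * E' = 1 ∧ E' * E = 1 ∧ E * U = fromRows 1 0 := by
  have hli : LinearIndependent ℂ U.col := by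
    rw [← Matrix.mulVec_injective_iff]
    intro v w hvw
    have := congrArg (L *ᵥ ·) hvw
    simpa [Matrix.mulVec_mulVec, h] using this
  obtain ⟨s, c, hc⟩ : ∃ (s : ℕ) (c : Module.Basis (Fin r ⊕ Fin s) ℂ (Fin m → ℂ)),
      ∀ j, c (Sum.inl j) = U.col j := by
    let b := Module.Basis.sumExtend hli
    have : Fintype (Fin r ⊕ Module.Basis.sumExtendIndex hli) :=
      @Fintype.ofFinite _ (Module.Finite.finite_basis b)
    have : Fintype (Module.Basis.sumExtendIndex hli) := Fintype.sumRight (α := Fin r)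
    refine ⟨_, b.reindex (Equiv.sumCongr (Equiv.refl (Fin r)) (Fintype.equivFin _)), fun j => ?_⟩
    simp only [b, Module.Basis.sumExtend, Module.Basis.reindex_apply]
    simp
    rfl
  have hcard := Module.finrank_eq_card_basis c
  let J : Matrix (Fin r ⊕ Fin s) (Fin r) ℂ := fromRows 1 0
  have hU : (Pi.basisFun ℂ (Fin m)).toMatrix c * J = U := by
    ext i j
    rw [Matrix.mul_apply, Fintype.sum_sum_type]
    simp [J, Module.Basis.toMatrix_apply, hc, Matrix.one_apply]
  refine ⟨s, by simpa using hcard, c.toMatrix (Pi.basisFun ℂ (Fin m)),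
    (Pi.basisFun ℂ (Fin m)).toMatrix c, Module.Basis.toMatrix_mul_toMatrix_flip _ _,
    Module.Basis.toMatrix_mul_toMatrix_flip _ _, ?_⟩
  rw [← hU, ← Matrix.mul_assoc, Module.Basis.toMatrix_mul_toMatrix_flip, Matrix.one_mul]

section Elimination

variable {R ι κ ρ μ ν : Type*} [CommRing R] [Fintype ι] [Fintype κ] [Fintype ρ] [Fintype μ]
  [Fintype ν] [DecidableEq ι] [DecidableEq κ] [DecidableEq ρ] [DecidableEq μ] [DecidableEq ν]

/-- Let `U` and `W` be completed to invertible matrices and let `T` be invertible, with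
`T + x A₁₁` invertible in the adapted bases. The pencil `[-xT, TW; UT, A]` and the matrix
`xA + UTW` reduce to the same Schur complement, up to a factor `x`. -/
theorem exists_matEquiv_schur (x : R) (A : Matrix ι κ R) (T T' : Matrix ρ ρ R)
    (U : Matrix ι ρ R) (W : Matrix ρ κ R) (hT : T' * T = 1)
    {E : Matrix (ρ ⊕ μ) ι R} {E' : Matrix ι (ρ ⊕ μ) R} (hE : E * E' = 1) (hE' : E' * E = 1)
    (hU : E * U = fromRows 1 0)
    {F : Matrix κ (ρ ⊕ ν) R} {F' : Matrix (ρ ⊕ ν) κ R} (hF : F * F' = 1) (hF' : F' * F = 1)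
    (hW : W * F = fromCols 1 0)
    (hinv : IsUnit (T + x • (E * A * F).toBlocks₁₁)) :
    ∃ S : Matrix μ ν R,
      MatEquiv (fromBlocks (-(x • T)) (T * W) (U * T) A)
        (fromBlocks (1 : Matrix ρ ρ R) 0 0 (fromBlocks (1 : Matrix ρ ρ R) 0 0 S)) ∧
      MatEquiv (x • A + U * T * W) (fromBlocks (1 : Matrix ρ ρ R) 0 0 (x • S)) := by
  obtain ⟨⟨Y, Z, hYZ, hZY⟩, rfl : Y = _⟩ := hinv
  have hT' : T * T' = 1 := mul_eq_one_comm.mp hT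
  set A₁₁ := (E * A * F).toBlocks₁₁
  set A₁₂ := (E * A * F).toBlocks₁₂
  set A₂₁ := (E * A * F).toBlocks₂₁
  set A₂₂ := (E * A * F).toBlocks₂₂
  have hEAF : E * A * F = fromBlocks A₁₁ A₁₂ A₂₁ A₂₂ := (fromBlocks_toBlocks _).symm
  refine ⟨A₂₂ - x • (A₂₁ * Z * A₁₂), ?_, ?_⟩
  · have h1 : MatEquiv (fromBlocks (-(x • T)) (T * W) (U * T) A)
        (fromBlocks (-(x • T)) (fromCols T 0) (fromRows T 0) (E * A * F)) := by
      refine ⟨fromBlocks 1 0 0 E, fromBlocks 1 0 0 E', fromBlocks 1 0 0 F, fromBlocks 1 0 0 F',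
        by simp [fromBlocks_multiply, *], by simp [fromBlocks_multiply, *],
        by simp [fromBlocks_multiply, *], by simp [fromBlocks_multiply, *], ?_⟩
      simp only [fromBlocks_multiply, Matrix.one_mul, Matrix.mul_one, Matrix.zero_mul,
        Matrix.mul_zero, add_zero, zero_add, Matrix.mul_assoc, hW]
      rw [← Matrix.mul_assoc E U, hU]
      congr 1
      · rw [Matrix.mul_fromCols]; simp
      · rw [Matrix.fromRows_mul]; simp
    have h2 := matEquiv_reindex (fromBlocks (-(x • T)) (fromCols T 0) (fromRows T 0) (E * A * F))
      (Equiv.sumAssoc ρ ρ μ).symm (Equiv.sumAssoc ρ ρ ν).symm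
    have h3 : (fromBlocks (-(x • T)) (fromCols T 0) (fromRows T 0) (E * A * F)).reindex
        (Equiv.sumAssoc ρ ρ μ).symm (Equiv.sumAssoc ρ ρ ν).symm =
        fromBlocks (fromBlocks (-(x • T)) T T A₁₁) (fromRows 0 A₁₂) (fromCols 0 A₂₁) A₂₂ := by
      rw [hEAF]
      ext i j
      rcases i with (i | i) | i <;> rcases j with (j | j) | j <;> rfl
    rw [h3] at h2
    have hinv' : fromBlocks (-(Z * A₁₁ * T')) Z (T' - x • (Z * A₁₁ * T')) (x • Z) *
        fromBlocks (-(x • T)) T T A₁₁ = 1 := by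
      have e1 : Z * T + x • (Z * A₁₁) = 1 := by
        rw [← hZY, Matrix.mul_add, Matrix.mul_smul]
      rw [fromBlocks_multiply, ← fromBlocks_one]
      congr 1
      · rw [Matrix.neg_mul, Matrix.mul_neg, neg_neg, Matrix.mul_smul, Matrix.mul_assoc _ T' T, hT, Matrix.mul_one,
          add_comm, e1]
      · rw [Matrix.neg_mul, Matrix.mul_assoc _ T' T, hT, Matrix.mul_one, neg_add_cancel]
      · rw [Matrix.mul_neg, Matrix.mul_smul, Matrix.sub_mul, Matrix.smul_mul,
          Matrix.mul_assoc _ T' T, hT, Matrix.mul_one, Matrix.smul_mul, ← smul_neg, ← smul_add,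
          neg_sub, sub_add_eq_add_sub, add_comm, e1, sub_self, smul_zero]
      · rw [Matrix.sub_mul, Matrix.smul_mul, Matrix.mul_assoc _ T' T, hT, Matrix.mul_one,
          Matrix.smul_mul, sub_add_cancel]
    have h4 := matEquiv_schur _ _ hinv' (fromRows (0 : Matrix ρ ν R) A₁₂)
      (fromCols (0 : Matrix μ ρ R) A₂₁) A₂₂
    have h5 : A₂₂ - fromCols (0 : Matrix μ ρ R) A₂₁ *
        fromBlocks (-(Z * A₁₁ * T')) Z (T' - x • (Z * A₁₁ * T')) (x • Z) *
          fromRows (0 : Matrix ρ ν R) A₁₂ =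
        A₂₂ - x • (A₂₁ * Z * A₁₂) := by
      rw [Matrix.mul_assoc, fromBlocks_mul_fromRows, fromCols_mul_fromRows]
      simp [Matrix.mul_assoc]
    rw [h5] at h4
    have h6 := matEquiv_reindex (fromBlocks (1 : Matrix (ρ ⊕ ρ) (ρ ⊕ ρ) R) 0 0
      (A₂₂ - x • (A₂₁ * Z * A₁₂))) (Equiv.sumAssoc ρ ρ μ) (Equiv.sumAssoc ρ ρ ν)
    have h7 : (fromBlocks (1 : Matrix (ρ ⊕ ρ) (ρ ⊕ ρ) R) 0 0
      (A₂₂ - x • (A₂₁ * Z * A₁₂))).reindex (Equiv.sumAssoc ρ ρ μ) (Equiv.sumAssoc ρ ρ ν) =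
        fromBlocks 1 0 0 (fromBlocks 1 0 0 (A₂₂ - x • (A₂₁ * Z * A₁₂))) := by
      rw [← fromBlocks_one]
      ext i j
      rcases i with i | i | i <;> rcases j with j | j | j <;> rfl
    rw [h7] at h6
    exact h1.trans (h2.trans (h4.trans h6))
  · have h1 : MatEquiv (x • A + U * T * W)
        (fromBlocks (T + x • A₁₁) (x • A₁₂) (x • A₂₁) (x • A₂₂)) := by
      refine ⟨E, E', F, F', hE, hE', hF, hF', ?_⟩
      calc E * (x • A + U * T * W) * F = x • (E * A * F) + (E * U) * T * (W * F) := by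
            simp [Matrix.mul_add, Matrix.add_mul, Matrix.mul_assoc]
        _ = _ := by
            rw [hU, hW, hEAF, Matrix.fromRows_mul, fromRows_mul_fromCols, fromBlocks_smul,
              fromBlocks_add]
            simp [add_comm]
    have h2 := matEquiv_schur _ _ hZY (x • A₁₂) (x • A₂₁) (x • A₂₂)
    have h3 : x • A₂₂ - x • A₂₁ * Z * x • A₁₂ = x • (A₂₂ - x • (A₂₁ * Z * A₁₂)) := by
      simp [smul_sub]
    rw [h3] at h2
    exact h1.trans h2

end Elimination

theorem normalRank_eq_rank_rev {m n : ℕ} (k : ℕ) (P : Matrix (Fin m) (Fin n) ℂ[X]) :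
    normalRank P = (rev k P).rank := by
  have hX : (RatFunc.X : RatFunc ℂ) ≠ 0 := RatFunc.X_ne_zero
  have htr : Transcendental ℂ (RatFunc.X : RatFunc ℂ)⁻¹ := fun h =>
    RatFunc.transcendental_X (by simpa using h.inv)
  have hinj := transcendental_iff_injective.mp htr
  let σ : RatFunc ℂ →+* RatFunc ℂ :=
    RatFunc.liftRingHom (aeval (RatFunc.X : RatFunc ℂ)⁻¹).toRingHom
      (nonZeroDivisors_le_comap_nonZeroDivisors_of_injective _ hinj)
  have h : rev k P = (RatFunc.X ^ k : RatFunc ℂ) • (toRat P).map σ := by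
    ext i j
    simp [rev, toRat, σ, RatFunc.liftRingHom_algebraMap]
  rw [h, rank_smul_of_mem_nonZeroDivisors _ (mem_nonZeroDivisors_of_ne_zero (pow_ne_zero _ hX)),
    rank_map_ringHom]
  rfl

/-- The inclusion of the constants in the local ring at `0`. -/
noncomputable def localC : ℂ →+* regularAtZero :=
  RingHom.codRestrict RatFunc.C regularAtZero fun c => by
    rw [← RatFunc.algebraMap_C]; exact algebraMap_mem_regularAtZero _

theorem coe_localC (c : ℂ) : (localC c : RatFunc ℂ) = RatFunc.C c := rfl

theorem evalZero_localC (c : ℂ) : evalZero (localC c) = c := RatFunc.eval_C _ _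

theorem rev_pencil {m n r : ℕ} (P₀ P₁ : Matrix (Fin m) (Fin n) ℂ) (T : Matrix (Fin r) (Fin r) ℂ)
    (U : Matrix (Fin m) (Fin r) ℂ) (V : Matrix (Fin n) (Fin r) ℂ) :
    rev 1 (pencil P₀ P₁ T U V) =
      ((fromBlocks (-(localX • T.map localC)) (T.map localC * Vᴴ.map localC)
        (U.map localC * T.map localC) (P₁.map localC + localX • P₀.map localC)).reindex
          finSumFinEquiv finSumFinEquiv).map regularAtZero.subtype := by
  have hX : (RatFunc.X : RatFunc ℂ) ≠ 0 := RatFunc.X_ne_zero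
  rw [← Matrix.map_mul, ← Matrix.map_mul]
  ext i j
  obtain ⟨i, rfl⟩ := finSumFinEquiv.surjective i
  obtain ⟨j, rfl⟩ := finSumFinEquiv.surjective j
  rcases i with i | i <;> rcases j with j | j <;>
    simp [rev, pencil, coe_localX, coe_localC, mul_add, -Matrix.map_mul]
  all_goals field_simp

theorem rev_quadratic {m n : ℕ} (P₀ P₁ P₂ : Matrix (Fin m) (Fin n) ℂ) :
    rev 2 (quadratic P₀ P₁ P₂) =
      (localX • (P₁.map localC + localX • P₀.map localC) + P₂.map localC).map
        regularAtZero.subtype := by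
  have hX : (RatFunc.X : RatFunc ℂ) ≠ 0 := RatFunc.X_ne_zero
  ext i j
  simp [rev, quadratic, coe_localX, coe_localC]
  field_simp
  ring

theorem multiplicities_of_adapted {m n r : ℕ} {P₀ P₁ : Matrix (Fin (r + m)) (Fin (r + n)) ℂ}
    {T : Matrix (Fin r) (Fin r) ℂ} {U : Matrix (Fin (r + m)) (Fin r) ℂ}
    {V : Matrix (Fin (r + n)) (Fin r) ℂ} (hT : IsUnit T)
    {E : Matrix (Fin r ⊕ Fin m) (Fin (r + m)) ℂ} {E' : Matrix (Fin (r + m)) (Fin r ⊕ Fin m) ℂ}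
    (hE : E * E' = 1) (hE' : E' * E = 1) (hU : E * U = fromRows 1 0)
    {F : Matrix (Fin (r + n)) (Fin r ⊕ Fin n) ℂ} {F' : Matrix (Fin r ⊕ Fin n) (Fin (r + n)) ℂ}
    (hF : F * F' = 1) (hF' : F' * F = 1) (hV : Vᴴ * F = fromCols 1 0) :
    ∃ d : List ℕ, d.Pairwise (· ≤ ·) ∧
      (∀ e, IsPartialMultiplicities (rev 1 (pencil P₀ P₁ T U V)) 0 e ↔
        e = d.filter (fun k => 0 < k)) ∧
      (∀ f, IsPartialMultiplicities (rev 2 (quadratic P₀ P₁ (U * T * Vᴴ))) 0 f ↔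
        f = d.map (· + 1)) ∧
      normalRank (quadratic P₀ P₁ (U * T * Vᴴ)) = r + d.length := by
  have hmap : ∀ {a b c : Type} [Fintype b] (M : Matrix a b ℂ) (N : Matrix b c ℂ),
      M.map localC * N.map localC = (M * N).map localC := fun M N => (Matrix.map_mul).symm
  have hone : ∀ {a : Type} [DecidableEq a], (1 : Matrix a a ℂ).map localC = 1 :=
    Matrix.map_one _ (map_zero _) (map_one _)
  obtain ⟨⟨T, T', hTT', hT'T⟩, rfl⟩ := hT
  obtain ⟨S, h1, h2⟩ := exists_matEquiv_schur localX (P₁.map localC + localX • P₀.map localC)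
    (T.map localC) (T'.map localC) (U.map localC) (Vᴴ.map localC) (by rw [hmap, hT'T, hone])
    (E := E.map localC) (E' := E'.map localC) (by rw [hmap, hE, hone]) (by rw [hmap, hE', hone])
    (by rw [hmap, hU]; ext i j; rcases i with i | i <;> simp [Matrix.one_apply, apply_ite])
    (F := F.map localC) (F' := F'.map localC) (by rw [hmap, hF, hone]) (by rw [hmap, hF', hone])
    (by rw [hmap, hV]; ext i j; rcases j with j | j <;> simp [Matrix.one_apply, apply_ite])
    (by
      rw [Matrix.isUnit_iff_isUnit_det, isUnit_regularAtZero_iff, RingHom.map_det]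
      have : evalZero.mapMatrix (T.map localC + localX • (E.map localC *
          (P₁.map localC + localX • P₀.map localC) * F.map localC).toBlocks₁₁) = T := by
        ext i j
        simp [evalZero_localX, evalZero_localC]
      rw [this]
      exact ((Matrix.isUnit_iff_isUnit_det T).mp ⟨⟨T, T', hTT', hT'T⟩, rfl⟩).ne_zero)
  obtain ⟨d, hm, hn, hs, -, hd⟩ := exists_matEquiv_powDiag exists_associated_localX_pow 0 S
    (by simp)
  have hs0 : ∀ {l : List ℕ} (a : ℕ), l.Pairwise (· ≤ ·) →
      (List.replicate a 0 ++ l).Pairwise (· ≤ ·) := fun a hl =>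
    List.pairwise_append.mpr ⟨List.pairwise_replicate.mpr (Or.inr le_rfl), hl,
      fun b hb c _ => by rw [List.eq_of_mem_replicate hb]; exact Nat.zero_le c⟩
  have hf0 : ∀ (a : ℕ), (List.replicate a 0).filter (fun k => 0 < k) = [] := by
    intro a; simp
  have hl : ∀ (l : List ℕ), (List.replicate r 0 ++ l).length = r + l.length := by simp
  rw [← powDiag_replicate_zero r localX] at h1 h2
  have h3 := h1.trans ((matEquiv_powDiag_append List.length_replicate hd).fromBlocks_diag _)
  have h4 := h3.trans (matEquiv_powDiag_append List.length_replicate (MatEquiv.refl _))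
  have hd' := hd.smul localX
  rw [smul_powDiag] at hd'
  have h5 := h2.trans (matEquiv_powDiag_append List.length_replicate hd')
  have hs1 : (d.map (· + 1)).Pairwise (· ≤ ·) := by
    rw [List.pairwise_map]
    exact hs.imp fun h => by omega
  rw [hmap, hmap] at h5
  have h6 := (matEquiv_reindex _ finSumFinEquiv finSumFinEquiv).symm.trans h4
  have e2 : rev 2 (quadratic P₀ P₁ (U * T * Vᴴ)) = _ := rev_quadratic _ _ _
  refine ⟨d, hs, fun e => ?_, fun f => ?_, ?_⟩
  · rw [rev_pencil, isPartialMultiplicities_iff (by simp; omega) (by simp; omega)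
      (hs0 r (hs0 r hs)) h6, List.filter_append, List.filter_append, hf0, List.nil_append,
      List.nil_append]
  · rw [e2, isPartialMultiplicities_iff (by simp; omega) (by simp; omega) (hs0 r hs1) h5,
      List.filter_append, hf0, List.nil_append, List.filter_eq_self.mpr]
    intro a ha
    obtain ⟨b, -, rfl⟩ := List.mem_map.mp ha
    simp
  · rw [normalRank_eq_rank_rev 2, e2, (h5.map regularAtZero.subtype).rank_eq, powDiag_map,
      rank_powDiag RatFunc.X_ne_zero (by simp; omega) (by simp; omega), hl, List.length_map]

end QuadLin

theorem mainTheorem3 {m n r₂ : ℕ} (P₀ P₁ P₂ : Matrix (Fin m) (Fin n) ℂ)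
    (T : Matrix (Fin r₂) (Fin r₂) ℂ) (U : Matrix (Fin m) (Fin r₂) ℂ)
    (V : Matrix (Fin n) (Fin r₂) ℂ)
    (hT : IsUnit T) (hU : Uᴴ * U = 1) (hV : Vᴴ * V = 1) (hP₂ : P₂ = U * T * Vᴴ) :
    (∃! e : List ℕ,
      QuadLin.IsPartialMultiplicities (QuadLin.rev 1 (QuadLin.pencil P₀ P₁ T U V)) 0 e) ∧
    ∀ e : List ℕ,
      QuadLin.IsPartialMultiplicities (QuadLin.rev 1 (QuadLin.pencil P₀ P₁ T U V)) 0 e →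
        r₂ + e.length ≤ QuadLin.normalRank (QuadLin.quadratic P₀ P₁ P₂) ∧
        ∀ f : List ℕ,
          QuadLin.IsPartialMultiplicities (QuadLin.rev 2 (QuadLin.quadratic P₀ P₁ P₂)) 0 f ↔
            f = List.replicate
                  (QuadLin.normalRank (QuadLin.quadratic P₀ P₁ P₂) - r₂ - e.length) 1 ++
                e.map (fun k => k + 1) := by
  subst hP₂
  obtain ⟨m, rfl, E, E', hE, hE', hEU⟩ := QuadLin.exists_mul_eq_fromRows_one_zero hU
  obtain ⟨n, rfl, F, F', hF, hF', hFV⟩ := QuadLin.exists_mul_eq_fromRows_one_zero hV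
  have hVF : Vᴴ * Fᴴ = fromCols 1 0 := by
    rw [← conjTranspose_mul, hFV, conjTranspose_fromRows_eq_fromCols_conjTranspose]
    simp
  obtain ⟨d, hs, h1, h2, h3⟩ := QuadLin.multiplicities_of_adapted (P₀ := P₀) (P₁ := P₁) hT hE hE'
    hEU (F := Fᴴ) (F' := F'ᴴ) (by rw [← conjTranspose_mul, hF', conjTranspose_one])
    (by rw [← conjTranspose_mul, hF, conjTranspose_one]) hVF
  refine ⟨⟨_, (h1 _).mpr rfl, fun e he => (h1 e).mp he⟩, fun e he => ?_⟩
  obtain rfl := (h1 e).mp he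
  have hle := List.length_filter_le (fun k => decide (0 < k)) d
  refine ⟨by rw [h3]; omega, fun f => ?_⟩
  rw [h2, h3, Nat.add_sub_cancel_left]
  conv_lhs => rw [QuadLin.eq_replicate_append_filter_pos hs]
  simp
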